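/- **Model.** A computing-with-the-cloud (CWC) system $G=(V,E,w)$ is a directed graph whose nodes are a finite set $V_p$ of $n$ processing nodes and a set $V_c$ of cloud nodes (no link joins two cloud nodes); a link $e$ carries at most $w(e)\in\mathbb N$ bits per round. Let $G_p$ be the graph of the processing nodes and the links between them (local links). In each synchronous round every processing node, depending on its local state, sends messages over local links and issues read and write requests for positions of files stored at cloud nodes; it then receives the messages sent to it and the answers to its requests, and updates its state arbitrarily. The answers to reads and the written data are charged to the bandwidth of the cloud links (request descriptors are free), and no two nodes write the same position in the same round. A protocol is chosen knowing $G$ and $s$, but not the contents of the cloud. The system has ($s$-)fat links if all links and bandwidths are symmetric and every local link has bandwidth at least $s$. For $s\in\mathbb N$, the problem cCast is: given an $s$-bit string stored in a known file at a cloud node $v_c$, make every processing node know the string. **Timespan.** For $B\subseteq V_p$ let $b_c(B)=\sum_{i\in B}w(i,v_c)$, and let $N_r(i)$ be the set of processing nodes at most $r$ hops away from $i$ in $G_p$. Put $$k_s(i)=\min\bigl(\{\mathrm{diam}(G_p)\}\cup\{k\in\mathbb N : (k+1)\,b_c(N_k(i))\ge s\}\bigr),\qquad B_i=N_{k_s(i)}(i),$$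 $$Z_i=k_s(i)+\frac{s}{b_c(B_i)},\qquad Z_{\max}=\max_{i\in V_p}Z_i,$$ where $\mathrm{diam}(G_p)=\infty$ if $G_p$ is disconnected, $s/0=\infty$ for $s>0$, and $0/0=0$. **Theorem.** There is an absolute constant $C$ such that for every $s\in\mathbb N$ and every CWC system with $s$-fat links, $n\ge 2$ processing nodes, any cloud node $v_c$, and $Z_{\max}<\infty$ (which holds, for instance, if $G_p$ is connected and some processing node has positive bandwidth to $v_c$), cCast can be performed in at most $C\,\lceil Z_{\max}\rceil\log^2 n$ rounds. -/

import Mathlib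

/-- A computing-with-the-cloud system: a directed graph on processing nodes `P` and cloud nodes `K`,
with the bandwidth of every link in bits per round. There is no link between two cloud nodes, and
nothing can be sent where there is no link. -/
structure CWCSystem (P : Type*) (K : Type*) where
  graph : Digraph (P ⊕ K)
  bw : P ⊕ K → P ⊕ K → ℕ
  no_cloud_cloud : ∀ a b : K, ¬ graph.Adj (Sum.inr a) (Sum.inr b)
  bw_eq_zero : ∀ x y, ¬ graph.Adj x y → bw x y = 0

/-- The contents of the cloud: cloud node, file name, position in the file. -/
abbrev CloudStorage (K : Type*) := K → ℕ → ℕ → Bool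

/-- A request to a cloud node: read `len` consecutive bits of a file from position `start` on, or
write the string `data` into a file from position `start` on. -/
inductive CloudRequest where
  | read (file start len : ℕ)
  | write (file start : ℕ) (data : List Bool)

namespace CloudRequest

/-- Number of bits that the answer to a request carries over the link from the cloud node. -/
def readSize : CloudRequest → ℕ
  | read _ _ len => len
  | write _ _ _ => 0

/-- Number of bits that a request carries over the link to the cloud node. -/
def writeSize : CloudRequest → ℕ
  | read _ _ _ => 0
  | write _ _ data => data.length

/-- The answer of a cloud node with contents `m`; a write has an empty answer. -/
def answer (m : ℕ → ℕ → Bool) : CloudRequest → List Bool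
  | read file start len => (List.range len).map fun x => m file (start + x)
  | write _ _ _ => []

/-- The request writes the bit `b` at position `x` of file `f`. -/
def WritesBit (f x : ℕ) (b : Bool) : CloudRequest → Prop
  | read _ _ _ => False
  | write file start data => file = f ∧ start ≤ x ∧ data[x - start]? = some b

end CloudRequest

/-- A deterministic synchronous protocol. In every round a processing node sends a message to each
processing node and a list of requests to each cloud node, as a function of its local state;
it then receives the messages sent to it and the answers to its requests, and updates its state. -/
structure CWCProtocol (P : Type*) (K : Type*) where
  State : Type
  init : P → State
  send : P → State → P → List Bool
  request : P → State → K → List CloudRequest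
  update : P → State → (P → List Bool) → (K → List (List Bool)) → State
  output : P → State → List Bool

/-- A global configuration between two rounds. -/
structure CWCConfig {P K : Type*} (A : CWCProtocol P K) where
  state : P → A.State
  storage : CloudStorage K

namespace CWCConfig

variable {P K : Type*} {A : CWCProtocol P K}

/-- In the round that starts in `σ`, node `i` writes the bit `b` at position `x` of file `f` of
cloud node `c`. -/
def NodeWrites (σ : CWCConfig A) (i : P) (c : K) (f x : ℕ) (b : Bool) : Prop :=
  ∃ r ∈ A.request i (σ.state i) c, r.WritesBit f x b

open Classical in
/-- One round. Reads see the storage as it is at the start of the round. -/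
noncomputable def next (σ : CWCConfig A) : CWCConfig A where
  state i := A.update i (σ.state i)
    (fun j => A.send j (σ.state j) i)
    (fun c => (A.request i (σ.state i) c).map (CloudRequest.answer (σ.storage c)))
  storage c f x :=
    if ∃ i b, σ.NodeWrites i c f x b then decide (∃ i, σ.NodeWrites i c f x true)
    else σ.storage c f x

/-- The round that starts in `σ` is admissible in the system `G`: no link carries more bits than its
bandwidth in either kind of traffic, and writes are exclusive. -/
structure Admissible (G : CWCSystem P K) (σ : CWCConfig A) : Prop where
  local_le : ∀ i j, (A.send i (σ.state i) j).length ≤ G.bw (Sum.inl i) (Sum.inl j)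
  read_le : ∀ i c, ((A.request i (σ.state i) c).map CloudRequest.readSize).sum
    ≤ G.bw (Sum.inr c) (Sum.inl i)
  write_le : ∀ i c, ((A.request i (σ.state i) c).map CloudRequest.writeSize).sum
    ≤ G.bw (Sum.inl i) (Sum.inr c)
  exclusive : ∀ c f x i j b b', σ.NodeWrites i c f x b → σ.NodeWrites j c f x b' →
    i = j ∧ b = b'

end CWCConfig

/-- The configuration after `t` rounds of the protocol, with initial cloud contents `M`. -/
noncomputable def CWCProtocol.run {P K : Type*} (A : CWCProtocol P K) (M : CloudStorage K) :
    ℕ → CWCConfig A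
  | 0 => ⟨A.init, M⟩
  | t + 1 => (A.run M t).next

namespace CWCSystem

variable {P K : Type*} (G : CWCSystem P K)

/-- `s`-fat-links: all links are symmetric, and local links have bandwidth at least `s`. -/
structure FatLinks (s : ℕ) : Prop where
  adj_symm : ∀ x y, G.graph.Adj x y → G.graph.Adj y x
  bw_symm : ∀ x y, G.bw x y = G.bw y x
  local_ge : ∀ i j : P, G.graph.Adj (Sum.inl i) (Sum.inl j) → s ≤ G.bw (Sum.inl i) (Sum.inl j)

/-- The cCast problem for the `s`-bit string stored in file `f` of cloud node `c` can be performed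
in `T` rounds: some admissible protocol makes every processing node know the string after `T`
rounds, whatever the contents of the cloud. -/
def CCastIn (c : K) (f s T : ℕ) : Prop :=
  ∃ A : CWCProtocol P K, ∀ M : CloudStorage K,
    (∀ t < T, (A.run M t).Admissible G) ∧
    ∀ i, A.output i ((A.run M T).state i) = (List.range s).map (M c f)

/-- The hop graph `G_p` of the processing nodes and the local links. -/
def localGraph : SimpleGraph P :=
  SimpleGraph.fromRel fun i j => G.graph.Adj (Sum.inl i) (Sum.inl j)

variable [Fintype P]

open Classical in
/-- The ball of radius `r` around `i` in the hop metric of `G_p`. -/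
noncomputable def ball (r : ℕ∞) (i : P) : Finset P :=
  Finset.univ.filter fun j => G.localGraph.edist i j ≤ r

/-- Total cloud bandwidth, with respect to cloud node `c`, of a set of processing nodes. -/
def cloudBandwidth (c : K) (B : Finset P) : ℕ :=
  ∑ i ∈ B, G.bw (Sum.inl i) (Sum.inr c)

/-- The `s`-cloud radius of `i`. The diameter of a disconnected graph is infinite. -/
noncomputable def cloudRadius (c : K) (s : ℕ) (i : P) : ℕ∞ :=
  sInf ({G.localGraph.ediam} ∪
    Nat.cast '' {k : ℕ | s ≤ (k + 1) * G.cloudBandwidth c (G.ball k i)})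

/-- The `s`-cloud cluster of `i`. -/
noncomputable def cloudCluster (c : K) (s : ℕ) (i : P) : Finset P :=
  G.ball (G.cloudRadius c s i) i

open scoped ENNReal in
/-- The timespan of the `s`-cloud cluster of `i`; infinite if `s > 0` and the cluster has no cloud
bandwidth. -/
noncomputable def timespan (c : K) (s : ℕ) (i : P) : ℝ≥0∞ :=
  (G.cloudRadius c s i : ℝ≥0∞) + (s : ℝ≥0∞) / (G.cloudBandwidth c (G.cloudCluster c s i) : ℝ≥0∞)

open scoped ENNReal in
/-- The maximal timespan. -/
noncomputable def maxTimespan (c : K) (s : ℕ) : ℝ≥0∞ :=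
  ⨆ i : P, G.timespan c s i

end CWCSystem

/-! ### Cloud bandwidth of balls -/

namespace CWCSystem

variable {P K : Type*} (G : CWCSystem P K)

/-! Let `Z` be the rounded-up maximal timespan. Both summands of each timespan are at most `Z`, so
every ball of radius `Z` can read the string in `Z` rounds. Take a maximal family of disjoint
`Z`-balls and divide the string among the nodes of each (`exists_read_assignment`). By maximality
every node is within `2 * Z` of a centre, hence within `3 * Z` of a full set of readers. Fat links
carry the whole partially known string each round, so flooding it by disjunction causes no
congestion: `4 * Z` rounds suffice. -/

theorem mem_ball [Fintype P] {r : ℕ∞} {i j : P} :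
    j ∈ G.ball r i ↔ G.localGraph.edist i j ≤ r := by
  simp [ball]

/-- If the maximal timespan is finite, the ball of that radius around any node can read the whole
string within that many rounds. -/
theorem le_ceil_maxTimespan_mul_cloudBandwidth [Fintype P] (c : K) (s : ℕ)
    (h : G.maxTimespan c s ≠ ⊤) (i : P) :
    s ≤ ⌈(G.maxTimespan c s).toReal⌉₊ *
      G.cloudBandwidth c (G.ball ⌈(G.maxTimespan c s).toReal⌉₊ i) := by
  set Z := ⌈(G.maxTimespan c s).toReal⌉₊ with hZ
  have hi : G.timespan c s i ≤ (Z : ENNReal) := by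
    refine (le_iSup (fun i => G.timespan c s i) i).trans ?_
    change G.maxTimespan c s ≤ _
    rw [← ENNReal.ofReal_toReal h, ← ENNReal.ofReal_natCast]
    exact ENNReal.ofReal_le_ofReal (Nat.le_ceil _)
  have hk : G.cloudRadius c s i ≤ (Z : ℕ∞) := by
    rw [← ENat.toENNReal_le, ENat.toENNReal_coe]
    exact le_self_add.trans hi
  have hs := (le_add_self (a := (s : ENNReal) / _)).trans hi
  -- Zero bandwidth needs no separate case: the finite bound rules out `s / 0 = ⊤`, leaving only `s
  -- = 0`.
  rw [ENNReal.div_le_iff_le_mul (Or.inr (ENNReal.natCast_ne_top Z))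
    (Or.inl (ENNReal.natCast_ne_top _))] at hs
  have hs' : s ≤ Z * G.cloudBandwidth c (G.cloudCluster c s i) := by exact_mod_cast hs
  refine hs'.trans (Nat.mul_le_mul_left _ (Finset.sum_le_sum_of_subset fun j hj => ?_))
  exact G.mem_ball.2 ((G.mem_ball.1 hj).trans hk)

end CWCSystem

/-! ### Disjoint balls and division of the string -/

/-- Consecutive intervals of prescribed lengths cover an initial segment of `ℕ`. -/
theorem exists_offset_cover {P : Type*} (B : Finset P) (m : P → ℕ) :
    ∃ off : P → ℕ, ∀ x < ∑ j ∈ B, m j, ∃ j ∈ B, off j ≤ x ∧ x < off j + m j := by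
  classical
  induction B using Finset.induction_on with
  | empty => exact ⟨fun _ => 0, by simp⟩
  | insert a B ha ih =>
    obtain ⟨off, hoff⟩ := ih
    refine ⟨Function.update off a (∑ j ∈ B, m j), fun x hx => ?_⟩
    rw [Finset.sum_insert ha] at hx
    rcases lt_or_ge x (∑ j ∈ B, m j) with h | h
    · obtain ⟨j, hj, h1⟩ := hoff x h
      have hja : j ≠ a := fun e => ha (e ▸ hj)
      exact ⟨j, Finset.mem_insert_of_mem hj, by simpa [hja] using h1⟩
    · exact ⟨a, Finset.mem_insert_self _ _, by simpa using ⟨h, by omega⟩⟩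

/-- In a finite graph there are centres whose balls of radius `r` are disjoint, and such that every
node is within distance `2 * r` of a centre. -/
theorem SimpleGraph.exists_disjoint_balls {P : Type*} [Finite P] (H : SimpleGraph P) (r : ℕ∞) :
    ∃ S : Set P, (∀ a ∈ S, ∀ b ∈ S, ∀ j, H.edist a j ≤ r → H.edist b j ≤ r → a = b) ∧
      ∀ i, ∃ a ∈ S, H.edist i a ≤ r + r := by
  let D : Set P → Prop := fun S =>
    ∀ a ∈ S, ∀ b ∈ S, ∀ j, H.edist a j ≤ r → H.edist b j ≤ r → a = b
  obtain ⟨S, hS⟩ := Set.Finite.exists_maximal (Set.toFinite {S | D S}) ⟨∅, by simp [D]⟩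
  refine ⟨S, hS.1, fun i => ?_⟩
  by_contra! hi
  -- If `i` is farther than `2 * r` from all centres, its ball misses theirs, so `i` could be added
  -- to the maximal family.
  have hfar : ∀ a ∈ S, ∀ j, H.edist a j ≤ r → H.edist i j ≤ r → False := fun a ha j h1 h2 =>
    (hi a ha).not_ge <| H.edist_triangle.trans (add_le_add h2 (H.edist_comm ▸ h1))
  have hD : D (insert i S) := by
    rintro a (rfl | ha) b (rfl | hb) j h1 h2
    · rfl
    · exact (hfar b hb j h2 h1).elim
    · exact (hfar a ha j h1 h2).elim
    · exact hS.1 a ha b hb j h1 h2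
  have hmem : i ∈ S := hS.2 hD (Set.subset_insert i S) (Set.mem_insert i S)
  exact absurd (hi i hmem) (by simp)

/-- The nodes can be given intervals, of lengths proportional to their bandwidths, such that every
position is assigned to some node near any given node. -/
theorem CWCSystem.exists_read_assignment {P K : Type*} [Fintype P] (G : CWCSystem P K) (c : K)
    (s Z : ℕ) (h : ∀ i, s ≤ Z * G.cloudBandwidth c (G.ball Z i)) :
    ∃ start : P → ℕ, ∀ i, ∀ x < s, ∃ j, G.localGraph.edist i j ≤ (3 * Z : ℕ) ∧
      start j ≤ x ∧ x < start j + Z * G.bw (Sum.inl j) (Sum.inr c) := by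
  classical
  obtain ⟨S, hdisj, hnear⟩ := G.localGraph.exists_disjoint_balls (Z : ℕ∞)
  choose off hoff using fun a : P =>
    exists_offset_cover (G.ball Z a) fun j => Z * G.bw (Sum.inl j) (Sum.inr c)
  -- Disjointness makes the chosen centre the only possible one. Nodes outside all balls get the
  -- dummy start `0`; coverage never relies on them.
  refine ⟨fun j => if hj : ∃ a ∈ S, G.localGraph.edist a j ≤ Z then off hj.choose j else 0,
    fun i x hx => ?_⟩
  obtain ⟨a, ha, hia⟩ := hnear i
  obtain ⟨j, hj, hxj⟩ := hoff a x (by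
    rw [← Finset.mul_sum]; exact hx.trans_le (h a))
  rw [G.mem_ball] at hj
  have hex : ∃ a ∈ S, G.localGraph.edist a j ≤ Z := ⟨a, ha, hj⟩
  have hch : hex.choose = a :=
    hdisj _ hex.choose_spec.1 _ ha j hex.choose_spec.2 hj
  refine ⟨j, ?_, by simpa [dif_pos hex, hch] using hxj⟩
  calc G.localGraph.edist i j ≤ _ := G.localGraph.edist_triangle
    _ ≤ (Z : ℕ∞) + Z + Z := add_le_add hia hj
    _ = (3 * Z : ℕ) := by norm_cast; ring

/-! ### The flooding protocol and its invariants -/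

open Classical in
/-- Node `i` reads file `f` of the cloud node `c` sequentially from position `start i` on, `width i`
bits per round, while the string with the known bits, unknown ones being `false`, is flooded
through the graph `H` and combined by disjunction. -/
noncomputable def floodProtocol {P K : Type*} (H : SimpleGraph P) (c : K) (f s : ℕ)
    (start width : P → ℕ) : CWCProtocol P K where
  State := ℕ × (ℕ → Bool)
  init _ := (0, fun _ => false)
  send i σ j := if H.Adj i j then (List.range s).map σ.2 else []
  request i σ k := if k = c then [.read f (start i + σ.1 * width i) (width i)] else []
  update i σ msg ans := (σ.1 + 1, fun x =>
    σ.2 x || decide ((∃ j, (msg j)[x]? = some true) ∨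
      start i + σ.1 * width i ≤ x ∧
        ∃ a ∈ ans c, a[x - (start i + σ.1 * width i)]? = some true))
  output _ σ := (List.range s).map σ.2

namespace floodProtocol

variable {P K : Type*} (H : SimpleGraph P) (c : K) (f s : ℕ) (start width : P → ℕ)
  (M : CloudStorage K)

theorem not_nodeWrites (σ : CWCConfig (floodProtocol H c f s start width)) (i : P) (k : K)
    (g x : ℕ) (b : Bool) : ¬ σ.NodeWrites i k g x b := by
  rintro ⟨r, hr, hw⟩
  simp only [floodProtocol] at hr
  split_ifs at hr
  · rw [List.mem_singleton] at hr
    subst hr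
    exact hw
  · simp at hr

theorem admissible (G : CWCSystem P K) (hH : ∀ i j, H.Adj i j → s ≤ G.bw (Sum.inl i) (Sum.inl j))
    (hw : ∀ i, width i ≤ G.bw (Sum.inr c) (Sum.inl i))
    (σ : CWCConfig (floodProtocol H c f s start width)) : σ.Admissible G where
  local_le i j := by
    simp only [floodProtocol]
    split_ifs with h
    · simpa using hH i j h
    · simp
  read_le i k := by
    simp only [floodProtocol]
    split_ifs with h
    · subst h
      simpa [CloudRequest.readSize] using hw i
    · simp
  write_le i k := by
    simp only [floodProtocol]
    split_ifs with h <;> simp [CloudRequest.writeSize]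
  exclusive k g x i j b b' h := (not_nodeWrites H c f s start width σ i k g x b h).elim

theorem storage_run (t : ℕ) : ((floodProtocol H c f s start width).run M t).storage = M := by
  induction t with
  | zero => rfl
  | succ t ih =>
    funext k g x
    simp [CWCProtocol.run, CWCConfig.next, not_nodeWrites, ih]

theorem clock_run (t : ℕ) (i : P) :
    (((floodProtocol H c f s start width).run M t).state i).1 = t := by
  induction t with
  | zero => rfl
  | succ t ih => exact congrArg (· + 1) ih

/-- The bit at position `x` that node `i` holds after `t` rounds. -/
noncomputable def bit (t : ℕ) (i : P) (x : ℕ) : Bool :=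
  (((floodProtocol H c f s start width).run M t).state i).2 x

theorem bit_zero (i : P) (x : ℕ) : bit H c f s start width M 0 i x = false := rfl

theorem send_getElem?_eq_true (σ : ℕ × (ℕ → Bool)) (i j : P) (x : ℕ) :
    ((floodProtocol H c f s start width).send i σ j)[x]? = some true ↔
      x < s ∧ H.Adj i j ∧ σ.2 x = true := by
  simp only [floodProtocol]
  split_ifs with h
  · simp [List.getElem?_eq_some_iff, h]
  · simp [h]

theorem exists_answer_getElem?_eq_true (m : ℕ → ℕ → Bool) (σ : ℕ × (ℕ → Bool)) (i : P) (x : ℕ) :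
    (start i + σ.1 * width i ≤ x ∧
      ∃ a ∈ ((floodProtocol H c f s start width).request i σ c).map (CloudRequest.answer m),
        a[x - (start i + σ.1 * width i)]? = some true) ↔
      start i + σ.1 * width i ≤ x ∧ x < start i + (σ.1 + 1) * width i ∧ m f x = true := by
  refine and_congr_right fun hx => ?_
  have hlt : x < start i + (σ.1 + 1) * width i ↔ x - (start i + σ.1 * width i) < width i := by
    rw [add_mul]; omega
  simp [floodProtocol, CloudRequest.answer, List.getElem?_eq_some_iff, hlt,
    Nat.add_sub_cancel' hx]

theorem update_snd_eq_true (σ : ℕ × (ℕ → Bool)) (msg : P → List Bool)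
    (ans : K → List (List Bool)) (i : P) (x : ℕ) :
    Prod.snd (α := ℕ) (β := ℕ → Bool)
        ((floodProtocol H c f s start width).update i σ msg ans) x = true ↔
      σ.2 x = true ∨ (∃ j, (msg j)[x]? = some true) ∨
        start i + σ.1 * width i ≤ x ∧
          ∃ a ∈ ans c, a[x - (start i + σ.1 * width i)]? = some true := by
  simp [floodProtocol]

/-- The protocol never writes, so reads always see the initial contents `M`. All later invariants
use only this recurrence. -/
theorem bit_succ (t : ℕ) (i : P) (x : ℕ) :
    bit H c f s start width M (t + 1) i x = true ↔
      bit H c f s start width M t i x = true ∨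
      (x < s ∧ ∃ j, H.Adj j i ∧ bit H c f s start width M t j x = true) ∨
      (start i + t * width i ≤ x ∧ x < start i + (t + 1) * width i ∧ M c f x = true) := by
  let A := floodProtocol H c f s start width
  let σ := A.run M t
  refine (update_snd_eq_true H c f s start width (σ.state i) (fun j => A.send j (σ.state j) i)
    (fun k => (A.request i (σ.state i) k).map (CloudRequest.answer (σ.storage k))) i x).trans ?_
  refine or_congr_right (or_congr ?_ ?_)
  · rw [← exists_and_left]
    exact exists_congr fun j => send_getElem?_eq_true H c f s start width (σ.state j) j i x
  · refine (exists_answer_getElem?_eq_true H c f s start width _ (σ.state i) i x).trans ?_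
    rw [storage_run, clock_run]

/-- Only reading a true bit creates `true`, so the default `false` never corrupts a disjunction. -/
theorem bit_sound (t : ℕ) (i : P) (x : ℕ) (h : bit H c f s start width M t i x = true) :
    M c f x = true := by
  induction t generalizing i with
  | zero => simp [bit_zero] at h
  | succ t ih =>
    rcases (bit_succ H c f s start width M t i x).1 h with h | ⟨-, j, -, h⟩ | ⟨-, -, h⟩
    · exact ih i h
    · exact ih j h
    · exact h

theorem bit_mono (i : P) (x : ℕ) {t t' : ℕ} (htt : t ≤ t')
    (h : bit H c f s start width M t i x = true) : bit H c f s start width M t' i x = true := by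
  induction t', htt using Nat.le_induction with
  | base => exact h
  | succ n _ ih => exact (bit_succ H c f s start width M n i x).2 (Or.inl ih)

theorem bit_of_read (Z : ℕ) (i : P) (x : ℕ) (h1 : start i ≤ x) (h2 : x < start i + Z * width i)
    (hM : M c f x = true) : bit H c f s start width M Z i x = true := by
  induction Z with
  | zero => omega
  | succ Z ih =>
    rw [bit_succ]
    rcases lt_or_ge x (start i + Z * width i) with h | h
    · exact Or.inl (ih h)
    · exact Or.inr (Or.inr ⟨h, h2, hM⟩)

/-- Each edge of the walk costs one round. -/
theorem bit_of_walk {i j : P} (p : H.Walk i j) (t x : ℕ) (hx : x < s)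
    (h : bit H c f s start width M t j x = true) :
    bit H c f s start width M (t + p.length) i x = true := by
  induction p with
  | nil => exact h
  | cons hadj p ih =>
    rw [SimpleGraph.Walk.length_cons, ← add_assoc, bit_succ]
    exact Or.inr (Or.inl ⟨hx, _, hadj.symm, ih h⟩)

theorem bit_of_edist_le {i j : P} {d : ℕ} (hd : H.edist i j ≤ d) (t x : ℕ) (hx : x < s)
    (h : bit H c f s start width M t j x = true) :
    bit H c f s start width M (t + d) i x = true := by
  obtain ⟨p, hp⟩ := SimpleGraph.exists_walk_of_edist_ne_top
    (hd.trans_lt (ENat.natCast_lt_top d)).ne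
  rw [← hp] at hd
  exact bit_mono H c f s start width M i x (Nat.add_le_add_left (by exact_mod_cast hd) t)
    (bit_of_walk H c f s start width M p t x hx h)

end floodProtocol

/-! ### The round bound -/

/-- With fat links, if every ball of radius `Z` can read the string in `Z` rounds, then the string
can be made known to all processing nodes in `4 * Z` rounds. -/
theorem CWCSystem.FatLinks.cCastIn {P K : Type*} [Fintype P] {G : CWCSystem P K} {s : ℕ}
    (hG : G.FatLinks s) (c : K) (f Z : ℕ)
    (h : ∀ i, s ≤ Z * G.cloudBandwidth c (G.ball Z i)) : G.CCastIn c f s (Z + 3 * Z) := by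
  obtain ⟨start, hstart⟩ := G.exists_read_assignment c s Z h
  let width : P → ℕ := fun j => G.bw (Sum.inl j) (Sum.inr c)
  refine ⟨floodProtocol G.localGraph c f s start width, fun M => ⟨fun t _ => ?_, fun i => ?_⟩⟩
  · refine floodProtocol.admissible _ _ _ _ _ _ G (fun i j hij => ?_)
      (fun i => (hG.bw_symm _ _).le) _
    -- `fromRel` symmetrises adjacency, so the link may be given in the reverse direction.
    rw [localGraph, SimpleGraph.fromRel_adj] at hij
    exact hG.local_ge i j (hij.2.elim id (hG.adj_symm _ _))
  · refine List.map_congr_left fun x hx => ?_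
    rw [List.mem_range] at hx
    rw [Bool.eq_iff_iff]
    refine ⟨floodProtocol.bit_sound G.localGraph c f s start width M _ i x, fun hM => ?_⟩
    obtain ⟨j, hd, h1, h2⟩ := hstart i x hx
    exact floodProtocol.bit_of_edist_le _ _ _ _ _ _ _ hd Z x hx
      (floodProtocol.bit_of_read _ _ _ _ _ _ _ Z j x h1 h2 hM)

theorem mainTheorem3 :
    ∃ C : ℝ, ∀ (P : Type*) (K : Type*) [Fintype P] (G : CWCSystem P K) (c : K) (f s : ℕ),
      2 ≤ Fintype.card P → G.FatLinks s → G.maxTimespan c s ≠ ⊤ →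
        ∃ T : ℕ, G.CCastIn c f s T ∧
          (T : ℝ) ≤ C * ⌈(G.maxTimespan c s).toReal⌉₊ * Real.log (Fintype.card P) ^ 2 := by
  -- The logarithmic factor is slack: `4 * Z` rounds suffice, and `n ≥ 2` gives `log n ≥ log 2`.
  refine ⟨4 / Real.log 2 ^ 2, fun P K _ G c f s hn hG hZ => ⟨_, hG.cCastIn c f _
    (G.le_ceil_maxTimespan_mul_cloudBandwidth c s hZ), ?_⟩⟩
  have h2 : 0 < Real.log 2 := Real.log_pos one_lt_two
  have hlog : Real.log 2 ≤ Real.log (Fintype.card P) :=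
    Real.log_le_log two_pos (by exact_mod_cast hn)
  generalize ⌈(G.maxTimespan c s).toReal⌉₊ = Z
  have hsq : Real.log 2 ^ 2 ≤ Real.log (Fintype.card P) ^ 2 := by gcongr
  calc ((Z + 3 * Z : ℕ) : ℝ) = 4 / Real.log 2 ^ 2 * Z * Real.log 2 ^ 2 := by
        push_cast
        field_simp
        ring
    _ ≤ 4 / Real.log 2 ^ 2 * Z * Real.log (Fintype.card P) ^ 2 := by gcongr
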